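/- Let $W$ be the Wiener algebra of all functions $f(z)=\sum_{k\ge 0}\hat f(k)z^k$ holomorphic in the open unit disk $\mathbb{D}$ with $\|f\|_W:=\sum_{k\ge 0}|\hat f(k)|<\infty$. Fix $\lambda\in(0,1)$ and put $b_\lambda(z)=\frac{z-\lambda}{1-\lambda z}$. For $n\ge 1$ let $T_\lambda$ be the lower triangular $n\times n$ Toeplitz matrix with entries $$(T_\lambda)_{ii}=\lambda,\qquad (T_\lambda)_{ij}=(-\lambda)^{i-j-1}(1-\lambda^2)\ \text{ for } i>j,\qquad (T_\lambda)_{ij}=0\ \text{ for } i<j .$$ For $x\in\mathbb{C}^n$ let $$|x|:=\inf\Big\{\Big\|\sum_{j=1}^n x_j e_j+b_\lambda^n g\Big\|_W : g\in W\Big\},\qquad e_j(z)=\frac{\sqrt{1-\lambda^2}}{1-\lambda z}\,b_\lambda(z)^{j-1},$$ and for a complex $n\times n$ matrix $A$ let $\|A\|:=\sup\{|Ax| : |x|\le 1\}$. **Theorem 4.3 (lower bound).** For every $n\ge1$, $|\cdot|$ is a norm on $\mathbb{C}^n$, and $\|T_\lambda\|\le 1$. Moreover, for every $\zeta\in\mathbb{D}$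 with $\zeta\ne\lambda$ there is a constant $d=d(\lambda,\zeta)>0$, depending only on $\lambda$ and $\zeta$, such that for all $n\ge 1$ the matrix $\zeta-T_\lambda$ is invertible and $$|b_\lambda(\zeta)|^n\,\big\|(\zeta-T_\lambda)^{-1}\big\|\ \ge\ d\,\sqrt{n}.$$ -/

import Mathlib

noncomputable section

/-- The `k`-th Taylor coefficient at the origin of a function holomorphic in the unit disk. -/
def taylorCoeff (f : ℂ → ℂ) (k : ℕ) : ℂ :=
  iteratedDeriv k f 0 / (k.factorial : ℂ)

/-- Membership in the Wiener algebra `W`: holomorphic in the open unit disk, with an absolutely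
summable sequence of Taylor coefficients. Elements of `W` are functions on the disk; the values
of `f` outside of it play no role. -/
structure MemWiener (f : ℂ → ℂ) : Prop where
  differentiableOn : DifferentiableOn ℂ f (Metric.ball 0 1)
  summable : Summable fun k : ℕ => ‖taylorCoeff f k‖

/-- The norm of the Wiener algebra. -/
def wienerNorm (f : ℂ → ℂ) : ℝ :=
  ∑' k : ℕ, ‖taylorCoeff f k‖

/-- The Blaschke factor `(z - λ) / (1 - λ z)` with real zero `λ`. -/
def blaschkeFactor (lam : ℝ) (z : ℂ) : ℂ :=
  (z - lam) / (1 - lam * z)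

/-- The Malmquist-Walsh functions for the zeros `λ, λ, …` with real `λ`, indexed from `0`. -/
def malmquistWalsh (lam : ℝ) (j : ℕ) (z : ℂ) : ℂ :=
  (Real.sqrt (1 - lam ^ 2) : ℂ) / (1 - lam * z) * blaschkeFactor lam z ^ j

/-- The norm on `ℂⁿ` transported from the quotient `W / BW`, where `B` is the `n`-th power of the
Blaschke factor: a vector `x` is sent to the class of `∑ⱼ xⱼ eⱼ`, and its norm is the infimum of
the Wiener norms of the representatives of this class. -/
def modelNorm (lam : ℝ) (n : ℕ) (x : Fin n → ℂ) : ℝ :=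
  sInf {r : ℝ | ∃ g : ℂ → ℂ, MemWiener g ∧
    r = wienerNorm fun z =>
      (∑ j : Fin n, x j * malmquistWalsh lam j z) + blaschkeFactor lam z ^ n * g z}

/-- `N` is a norm on the complex vector space `ℂⁿ`. -/
structure IsVectorNorm {n : ℕ} (N : (Fin n → ℂ) → ℝ) : Prop where
  eq_zero_iff : ∀ x, N x = 0 ↔ x = 0
  smul : ∀ (c : ℂ) (x), N (c • x) = ‖c‖ * N x
  add_le : ∀ x y, N (x + y) ≤ N x + N y

/-- The matrix norm induced by the vector norm `N`. -/
def inducedNorm {n : ℕ} (N : (Fin n → ℂ) → ℝ) (A : Matrix (Fin n) (Fin n) ℂ) : ℝ :=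
  sSup {r : ℝ | ∃ x : Fin n → ℂ, N x ≤ 1 ∧ r = N (A.mulVec x)}

/-- The lower triangular Toeplitz matrix with `λ` on the diagonal and
`(-λ) ^ (i - j - 1) * (1 - λ ^ 2)` in position `(i, j)` for `i > j`, with real `λ`. -/
def toeplitzMatrix (lam : ℝ) (n : ℕ) : Matrix (Fin n) (Fin n) ℂ :=
  Matrix.of fun i j =>
    if i = j then (lam : ℂ)
    else if j < i then (-(lam : ℂ)) ^ ((i : ℕ) - (j : ℕ) - 1) * (1 - (lam : ℂ) ^ 2)
    else 0

end

open Metric Filter Topology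

/-- `f` is given on the open unit disk by the power series with absolutely summable coefficients
`a`. -/
structure HasWienerSeries (f : ℂ → ℂ) (a : ℕ → ℂ) : Prop where
  summable : Summable fun k => ‖a k‖
  hasSum : ∀ z ∈ ball (0 : ℂ) 1, HasSum (fun k => a k * z ^ k) (f z)

theorem MemWiener.hasWienerSeries {f : ℂ → ℂ} (hf : MemWiener f) :
    HasWienerSeries f (taylorCoeff f) := by
  refine ⟨hf.summable, fun z hz => ?_⟩
  have h := Complex.hasSum_taylorSeries_on_ball hf.differentiableOn hz
  refine h.congr_fun fun k => ?_
  simp only [taylorCoeff, sub_zero, smul_eq_mul]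
  ring

namespace HasWienerSeries

variable {f g : ℂ → ℂ} {a b : ℕ → ℂ}

theorem summable_norm_mul_pow (h : HasWienerSeries f a) {z : ℂ} (hz : z ∈ closedBall (0 : ℂ) 1) :
    Summable fun k => ‖a k * z ^ k‖ := by
  refine h.summable.of_nonneg_of_le (fun k => norm_nonneg _) fun k => ?_
  rw [norm_mul, norm_pow]
  exact mul_le_of_le_one_right (norm_nonneg _)
    (pow_le_one₀ (norm_nonneg _) (by simpa using hz))

theorem hasFPowerSeriesAt (h : HasWienerSeries f a) :
    HasFPowerSeriesAt f (FormalMultilinearSeries.ofScalars ℂ a) 0 := by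
  rw [hasFPowerSeriesAt_iff]
  filter_upwards [ball_mem_nhds (0 : ℂ) one_pos] with z hz
  simpa [FormalMultilinearSeries.coeff_ofScalars, mul_comm] using h.hasSum z hz

theorem differentiableOn (h : HasWienerSeries f a) : DifferentiableOn ℂ f (ball 0 1) := by
  have : DifferentiableOn ℂ (fun z => ∑' k, a k * z ^ k) (ball 0 1) := by
    refine Complex.differentiableOn_tsum_of_summable_norm h.summable
      (fun k => by fun_prop) isOpen_ball fun k z hz => ?_
    rw [norm_mul, norm_pow]
    exact mul_le_of_le_one_right (norm_nonneg _)
      (pow_le_one₀ (norm_nonneg _) (by simpa using (mem_ball_zero_iff.1 hz).le))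
  exact this.congr fun z hz => (h.hasSum z hz).tsum_eq.symm

theorem taylorCoeff_eq (h : HasWienerSeries f a) : taylorCoeff f = a := by
  have h2 : HasFPowerSeriesAt f (FormalMultilinearSeries.ofScalars ℂ (taylorCoeff f)) 0 := by
    rw [hasFPowerSeriesAt_iff]
    filter_upwards [ball_mem_nhds (0 : ℂ) one_pos] with z hz
    have := Complex.hasSum_taylorSeries_on_ball h.differentiableOn hz
    simp only [FormalMultilinearSeries.coeff_ofScalars, zero_add]
    refine this.congr_fun fun k => ?_
    simp only [taylorCoeff, sub_zero, smul_eq_mul]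
    ring
  have := h2.eq_formalMultilinearSeries h.hasFPowerSeriesAt
  exact FormalMultilinearSeries.ofScalars_series_injective ℂ ℂ this

theorem memWiener (h : HasWienerSeries f a) : MemWiener f :=
  ⟨h.differentiableOn, by rw [h.taylorCoeff_eq]; exact h.summable⟩

theorem wienerNorm_eq (h : HasWienerSeries f a) : wienerNorm f = ∑' k, ‖a k‖ := by
  rw [wienerNorm, h.taylorCoeff_eq]

theorem congr (h : HasWienerSeries f a) (hfg : ∀ z ∈ ball (0 : ℂ) 1, g z = f z) :
    HasWienerSeries g a :=
  ⟨h.summable, fun z hz => by rw [hfg z hz]; exact h.hasSum z hz⟩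

theorem add (hf : HasWienerSeries f a) (hg : HasWienerSeries g b) :
    HasWienerSeries (fun z => f z + g z) fun k => a k + b k := by
  refine ⟨(hf.summable.add hg.summable).of_nonneg_of_le (fun k => norm_nonneg _)
    fun k => norm_add_le _ _, fun z hz => ?_⟩
  simpa only [add_mul] using (hf.hasSum z hz).add (hg.hasSum z hz)

theorem mul (hf : HasWienerSeries f a) (hg : HasWienerSeries g b) :
    HasWienerSeries (fun z => f z * g z)
      fun k => ∑ p ∈ Finset.HasAntidiagonal.antidiagonal k, a p.1 * b p.2 := by
  refine ⟨summable_norm_sum_mul_antidiagonal_of_summable_norm hf.summable hg.summable,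
    fun z hz => ?_⟩
  have hz' := ball_subset_closedBall hz
  have hs := hf.summable_norm_mul_pow hz'
  have ht := hg.summable_norm_mul_pow hz'
  have h1 := tsum_mul_tsum_eq_tsum_sum_antidiagonal_of_summable_norm hs ht
  have h2 := (summable_norm_sum_mul_antidiagonal_of_summable_norm hs ht).of_norm.hasSum
  rw [← h1, (hf.hasSum z hz).tsum_eq, (hg.hasSum z hz).tsum_eq] at h2
  refine h2.congr_fun fun k => ?_
  rw [Finset.sum_mul]
  refine Finset.sum_congr rfl fun p hp => ?_
  rw [← Finset.HasAntidiagonal.mem_antidiagonal.1 hp]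
  ring

end HasWienerSeries

theorem hasWienerSeries_const (c : ℂ) : HasWienerSeries (fun _ => c) (Pi.single 0 c) := by
  have h0 : ∀ k, k ≠ 0 → (Pi.single 0 c : ℕ → ℂ) k = 0 := fun k hk => by simp [hk]
  refine ⟨(hasSum_single 0 fun k hk => by simp [h0 k hk]).summable, fun z _ => ?_⟩
  have := hasSum_single (f := fun k => (Pi.single 0 c : ℕ → ℂ) k * z ^ k) 0
    fun k hk => by simp [h0 k hk]
  simpa using this

theorem hasWienerSeries_id : HasWienerSeries (fun z => z) (Pi.single 1 1) := by
  have h0 : ∀ k, k ≠ 1 → (Pi.single 1 1 : ℕ → ℂ) k = 0 := fun k hk => by simp [hk]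
  refine ⟨(hasSum_single 1 fun k hk => by simp [h0 k hk]).summable, fun z _ => ?_⟩
  have := hasSum_single (f := fun k => (Pi.single 1 1 : ℕ → ℂ) k * z ^ k) 1
    fun k hk => by simp [h0 k hk]
  simpa using this

theorem hasWienerSeries_one_div {lam : ℝ} (h0 : 0 < lam) (h1 : lam < 1) :
    HasWienerSeries (fun z => 1 / (1 - lam * z)) fun k => (lam : ℂ) ^ k := by
  refine ⟨?_, fun z hz => ?_⟩
  · simpa [abs_of_pos h0] using summable_geometric_of_lt_one h0.le h1
  · have : ‖(lam : ℂ) * z‖ < 1 := by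
      rw [norm_mul, Complex.norm_real, Real.norm_eq_abs, abs_of_pos h0]
      exact mul_lt_one_of_nonneg_of_lt_one_left h0.le h1 (by simpa using (mem_ball_zero_iff.1 hz).le)
    simpa only [mul_pow, one_div] using hasSum_geometric_of_norm_lt_one this

namespace MemWiener

variable {f g : ℂ → ℂ}

theorem congr (hf : MemWiener f) (hfg : ∀ z ∈ ball (0 : ℂ) 1, g z = f z) : MemWiener g :=
  (hf.hasWienerSeries.congr hfg).memWiener

theorem add (hf : MemWiener f) (hg : MemWiener g) : MemWiener fun z => f z + g z :=
  (hf.hasWienerSeries.add hg.hasWienerSeries).memWiener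

theorem mul (hf : MemWiener f) (hg : MemWiener g) : MemWiener fun z => f z * g z :=
  (hf.hasWienerSeries.mul hg.hasWienerSeries).memWiener

theorem const (c : ℂ) : MemWiener fun _ => c := (hasWienerSeries_const c).memWiener

theorem id : MemWiener fun z => z := hasWienerSeries_id.memWiener

theorem pow (hf : MemWiener f) (n : ℕ) : MemWiener fun z => f z ^ n := by
  induction n with
  | zero => simpa using const 1
  | succ n ih => simpa only [pow_succ] using ih.mul hf

theorem sum {ι : Type*} (s : Finset ι) {F : ι → ℂ → ℂ} (hF : ∀ i ∈ s, MemWiener (F i)) :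
    MemWiener fun z => ∑ i ∈ s, F i z := by
  classical
  induction s using Finset.induction_on with
  | empty => simpa using const 0
  | insert i s hi ih =>
    simp only [Finset.sum_insert hi]
    exact (hF i (by simp)).add (ih fun j hj => hF j (by simp [hj]))

end MemWiener

theorem wienerNorm_nonneg (f : ℂ → ℂ) : 0 ≤ wienerNorm f := tsum_nonneg fun _ => norm_nonneg _

theorem wienerNorm_congr {f g : ℂ → ℂ} (hf : MemWiener f)
    (hfg : ∀ z ∈ ball (0 : ℂ) 1, g z = f z) : wienerNorm g = wienerNorm f :=
  (hf.hasWienerSeries.congr hfg).wienerNorm_eq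

theorem wienerNorm_add_le {f g : ℂ → ℂ} (hf : MemWiener f) (hg : MemWiener g) :
    wienerNorm (fun z => f z + g z) ≤ wienerNorm f + wienerNorm g := by
  have h := hf.hasWienerSeries.add hg.hasWienerSeries
  rw [h.wienerNorm_eq, wienerNorm, wienerNorm, ← hf.summable.tsum_add hg.summable]
  exact h.summable.tsum_le_tsum (fun k => norm_add_le _ _) (hf.summable.add hg.summable)

theorem wienerNorm_mul_le {f g : ℂ → ℂ} (hf : MemWiener f) (hg : MemWiener g) :
    wienerNorm (fun z => f z * g z) ≤ wienerNorm f * wienerNorm g := by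
  have h := hf.hasWienerSeries.mul hg.hasWienerSeries
  have hs := summable_norm_sum_mul_antidiagonal_of_summable_norm
    (f := fun k => (‖taylorCoeff f k‖ : ℝ)) (g := fun k => (‖taylorCoeff g k‖ : ℝ))
    (by simpa using hf.summable) (by simpa using hg.summable)
  rw [h.wienerNorm_eq, wienerNorm, wienerNorm,
    tsum_mul_tsum_eq_tsum_sum_antidiagonal_of_summable_norm (by simpa using hf.summable)
      (by simpa using hg.summable)]
  refine h.summable.tsum_le_tsum (fun k => ?_) hs.of_norm
  refine (norm_sum_le _ _).trans_eq (Finset.sum_congr rfl fun p _ => norm_mul _ _)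

theorem wienerNorm_const (c : ℂ) : wienerNorm (fun _ => c) = ‖c‖ := by
  rw [(hasWienerSeries_const c).wienerNorm_eq, tsum_eq_single 0 fun k hk => by simp [hk]]
  simp

theorem wienerNorm_id : wienerNorm (fun z => z) = 1 := by
  rw [hasWienerSeries_id.wienerNorm_eq, tsum_eq_single 1 fun k hk => by simp [hk]]
  simp

theorem wienerNorm_one_div {lam : ℝ} (h0 : 0 < lam) (h1 : lam < 1) :
    wienerNorm (fun z => 1 / (1 - lam * z)) = (1 - lam)⁻¹ := by
  rw [(hasWienerSeries_one_div h0 h1).wienerNorm_eq]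
  simpa [abs_of_pos h0] using tsum_geometric_of_lt_one h0.le h1

/-- The continuous extension of a function of the Wiener algebra to the closed unit disk. -/
noncomputable def wienerExt (f : ℂ → ℂ) (z : ℂ) : ℂ := ∑' k, taylorCoeff f k * z ^ k

theorem wienerExt_eq {f : ℂ → ℂ} (hf : MemWiener f) {z : ℂ} (hz : z ∈ ball (0 : ℂ) 1) :
    wienerExt f z = f z := (hf.hasWienerSeries.hasSum z hz).tsum_eq

theorem continuousOn_wienerExt {f : ℂ → ℂ} (hf : MemWiener f) :
    ContinuousOn (wienerExt f) (closedBall 0 1) := by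
  refine continuousOn_tsum (fun k => by fun_prop) hf.summable fun k z hz => ?_
  rw [norm_mul, norm_pow]
  exact mul_le_of_le_one_right (norm_nonneg _) (pow_le_one₀ (norm_nonneg _) (by simpa using hz))

theorem diffContOnCl_wienerExt {f : ℂ → ℂ} (hf : MemWiener f) :
    DiffContOnCl ℂ (wienerExt f) (ball 0 1) :=
  ⟨hf.differentiableOn.congr fun _ hz => wienerExt_eq hf hz, by
    rw [closure_ball _ one_ne_zero]; exact continuousOn_wienerExt hf⟩

theorem wienerExt_eq_of_continuousOn {f F : ℂ → ℂ} (hf : MemWiener f)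
    (hF : ContinuousOn F (closedBall 0 1)) (hfF : ∀ z ∈ ball (0 : ℂ) 1, F z = f z) {z : ℂ}
    (hz : z ∈ closedBall (0 : ℂ) 1) : wienerExt f z = F z := by
  have : Set.EqOn (wienerExt f) F (ball 0 1) := fun w hw => by
    rw [wienerExt_eq hf hw, hfF w hw]
  refine this.of_subset_closure (continuousOn_wienerExt hf) hF ball_subset_closedBall ?_ hz
  rw [closure_ball _ one_ne_zero]

theorem norm_circleIntegral_wienerExt_mul_le {f G : ℂ → ℂ} (hf : MemWiener f)
    (hG : ContinuousOn G (sphere 0 1)) {C : ℝ}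
    (hC : ∀ k : ℕ, ‖∮ z in C(0, 1), z ^ k * G z‖ ≤ C) :
    ‖∮ z in C(0, 1), wienerExt f z * G z‖ ≤ C * wienerNorm f := by
  obtain ⟨K, hK⟩ := (isCompact_sphere (0 : ℂ) 1).exists_bound_of_continuousOn hG
  have hmem : ∀ t, circleMap 0 1 t ∈ sphere (0 : ℂ) 1 := fun t => circleMap_mem_sphere 0 zero_le_one t
  have hGc : Continuous fun t => G (circleMap 0 1 t) :=
    hG.comp_continuous (continuous_circleMap 0 1) hmem
  have key : HasSum (fun k => ∮ z in C(0, 1), taylorCoeff f k * z ^ k * G z)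
      (∮ z in C(0, 1), wienerExt f z * G z) := by
    unfold circleIntegral
    refine intervalIntegral.hasSum_integral_of_dominated_convergence
      (fun k _ => ‖taylorCoeff f k‖ * K) (fun k => ?_) (fun k => ?_) ?_ ?_ ?_
    · refine Continuous.aestronglyMeasurable ?_
      simp only [deriv_circleMap]
      have := continuous_circleMap 0 1
      exact (by fun_prop : Continuous fun t => circleMap 0 1 t * Complex.I).smul
        ((by fun_prop : Continuous fun t => taylorCoeff f k * circleMap 0 1 t ^ k).mul hGc)
    · refine Eventually.of_forall fun t _ => ?_
      simpa using mul_le_mul_of_nonneg_left (hK _ (hmem t)) (norm_nonneg _)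
    · exact Eventually.of_forall fun t _ => hf.summable.mul_right K
    · exact intervalIntegrable_const
    · refine Eventually.of_forall fun t _ => ?_
      have hs : HasSum (fun k => taylorCoeff f k * circleMap 0 1 t ^ k)
          (wienerExt f (circleMap 0 1 t)) :=
        (hf.hasWienerSeries.summable_norm_mul_pow
          (sphere_subset_closedBall (hmem t))).of_norm.hasSum
      exact (hs.mul_right _).const_smul _
  have hle : ∀ k, ‖∮ z in C(0, 1), taylorCoeff f k * z ^ k * G z‖ ≤ C * ‖taylorCoeff f k‖ := by
    intro k
    simp only [mul_assoc]
    rw [circleIntegral.integral_const_mul, norm_mul, mul_comm]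
    exact mul_le_mul_of_nonneg_right (hC k) (norm_nonneg _)
  rw [← key.tsum_eq, wienerNorm, ← tsum_mul_left]
  exact tsum_of_norm_bounded (hf.summable.mul_left C).hasSum hle

variable {lam : ℝ}

theorem one_sub_mul_ne_zero (h0 : 0 < lam) (h1 : lam < 1) {z : ℂ} (hz : z ∈ closedBall (0 : ℂ) 1) :
    1 - (lam : ℂ) * z ≠ 0 := by
  intro h
  have h2 : ‖(lam : ℂ) * z‖ = 1 := by rw [← sub_eq_zero.1 h, norm_one]
  rw [norm_mul, Complex.norm_real, Real.norm_eq_abs, abs_of_pos h0] at h2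
  have : ‖z‖ ≤ 1 := by simpa using hz
  nlinarith [norm_nonneg z]

theorem blaschkeFactor_mul (z : ℂ) (hz : 1 - (lam : ℂ) * z ≠ 0) :
    blaschkeFactor lam z * (1 - lam * z) = z - lam := div_mul_cancel₀ _ hz

theorem memWiener_one_div (h0 : 0 < lam) (h1 : lam < 1) :
    MemWiener fun z => 1 / (1 - lam * z) := (hasWienerSeries_one_div h0 h1).memWiener

theorem memWiener_blaschkeFactor (h0 : 0 < lam) (h1 : lam < 1) :
    MemWiener (blaschkeFactor lam) := by
  refine ((MemWiener.id.add (MemWiener.const (-lam))).mul (memWiener_one_div h0 h1)).congr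
    fun z _ => ?_
  rw [blaschkeFactor]; ring

theorem memWiener_malmquistWalsh (h0 : 0 < lam) (h1 : lam < 1) (j : ℕ) :
    MemWiener (malmquistWalsh lam j) := by
  refine (((MemWiener.const (Real.sqrt (1 - lam ^ 2) : ℂ)).mul (memWiener_one_div h0 h1)).mul
    ((memWiener_blaschkeFactor h0 h1).pow j)).congr fun z _ => ?_
  rw [malmquistWalsh]; ring

theorem differentiableAt_blaschkeFactor {z : ℂ} (hz : 1 - (lam : ℂ) * z ≠ 0) :
    DifferentiableAt ℂ (blaschkeFactor lam) z := by
  unfold blaschkeFactor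
  fun_prop (disch := assumption)

theorem differentiableAt_malmquistWalsh (j : ℕ) {z : ℂ} (hz : 1 - (lam : ℂ) * z ≠ 0) :
    DifferentiableAt ℂ (malmquistWalsh lam j) z := by
  have := differentiableAt_blaschkeFactor hz
  unfold malmquistWalsh
  fun_prop (disch := assumption)

/-- The function `∑ⱼ xⱼ eⱼ` with coordinates `x` in the Malmquist-Walsh basis. -/
noncomputable def modelFun (lam : ℝ) {n : ℕ} (x : Fin n → ℂ) (z : ℂ) : ℂ :=
  ∑ j : Fin n, x j * malmquistWalsh lam j z

section modelFun

variable {n : ℕ}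

theorem memWiener_modelFun (h0 : 0 < lam) (h1 : lam < 1) (x : Fin n → ℂ) :
    MemWiener (modelFun lam x) :=
  MemWiener.sum _ fun j _ => (MemWiener.const (x j)).mul (memWiener_malmquistWalsh h0 h1 j)

theorem differentiableAt_modelFun (x : Fin n → ℂ) {z : ℂ} (hz : 1 - (lam : ℂ) * z ≠ 0) :
    DifferentiableAt ℂ (modelFun lam x) z := by
  unfold modelFun
  exact DifferentiableAt.fun_sum fun j _ => (differentiableAt_malmquistWalsh j hz).const_mul _

theorem modelFun_add (x y : Fin n → ℂ) (z : ℂ) :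
    modelFun lam (x + y) z = modelFun lam x z + modelFun lam y z := by
  simp [modelFun, add_mul, Finset.sum_add_distrib]

theorem modelFun_sub (x y : Fin n → ℂ) (z : ℂ) :
    modelFun lam (x - y) z = modelFun lam x z - modelFun lam y z := by
  simp [modelFun, sub_mul, Finset.sum_sub_distrib]

theorem modelFun_smul (c : ℂ) (x : Fin n → ℂ) (z : ℂ) :
    modelFun lam (c • x) z = c * modelFun lam x z := by
  simp [modelFun, Finset.mul_sum, mul_assoc]

/-- Column `j` of the Toeplitz matrix expresses multiplication by `z` in powers of the Blaschke
factor. -/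
theorem sum_toeplitz_mul_blaschkeFactor_pow {z : ℂ} (hz : 1 - (lam : ℂ) * z ≠ 0) (j m : ℕ) :
    (∑ i ∈ Finset.range (j + 1 + m),
      (if i = j then (lam : ℂ) else if j < i then (-(lam : ℂ)) ^ (i - j - 1) * (1 - (lam : ℂ) ^ 2)
        else 0) * blaschkeFactor lam z ^ i) =
      z * blaschkeFactor lam z ^ j
        - (1 - lam * z) * (-(lam : ℂ)) ^ m * blaschkeFactor lam z ^ (j + 1 + m) := by
  have hb := blaschkeFactor_mul z hz
  induction m with
  | zero =>
    rw [add_zero, Finset.sum_range_succ, Finset.sum_eq_zero]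
    · simp only [if_true, pow_succ, pow_zero]
      linear_combination (blaschkeFactor lam z) ^ j * hb
    · intro i hi
      have := Finset.mem_range.1 hi
      rw [if_neg (by omega), if_neg (by omega), zero_mul]
  | succ m ih =>
    rw [← add_assoc, Finset.sum_range_succ, ih, if_neg (by omega), if_pos (by omega),
      show j + 1 + m - j - 1 = m by omega, pow_succ, pow_succ _ (j + 1 + m)]
    linear_combination (-(lam : ℂ)) ^ m * blaschkeFactor lam z ^ (j + 1 + m) * (-lam) * hb

/-- The coefficient of `b ^ n` in the product of `z` and `∑ⱼ xⱼ eⱼ`. -/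
noncomputable def shiftDefect (lam : ℝ) (x : Fin n → ℂ) : ℂ :=
  ∑ j : Fin n, x j * ((Real.sqrt (1 - lam ^ 2) : ℂ) * (-(lam : ℂ)) ^ (n - 1 - j))

theorem mul_modelFun (x : Fin n → ℂ) {z : ℂ} (hz : 1 - (lam : ℂ) * z ≠ 0) :
    z * modelFun lam x z =
      modelFun lam ((toeplitzMatrix lam n).mulVec x) z
        + shiftDefect lam x * blaschkeFactor lam z ^ n := by
  have hcol : ∀ j : Fin n, ∑ i : Fin n, toeplitzMatrix lam n i j * malmquistWalsh lam i z =
      z * malmquistWalsh lam j z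
        - Real.sqrt (1 - lam ^ 2) * (-(lam : ℂ)) ^ (n - 1 - j) * blaschkeFactor lam z ^ n := by
    intro j
    obtain ⟨m, hm⟩ : ∃ m, n = j + 1 + m := ⟨n - (j + 1), by omega⟩
    have h := sum_toeplitz_mul_blaschkeFactor_pow hz j m
    rw [← hm, ← Fin.sum_univ_eq_sum_range] at h
    rw [show n - 1 - (j : ℕ) = m by omega]
    have h2 : ∑ i : Fin n, toeplitzMatrix lam n i j * malmquistWalsh lam i z =
        Real.sqrt (1 - lam ^ 2) / (1 - lam * z) * ∑ i : Fin n,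
          (if (i : ℕ) = j then (lam : ℂ) else if (j : ℕ) < i then
            (-(lam : ℂ)) ^ ((i : ℕ) - j - 1) * (1 - (lam : ℂ) ^ 2) else 0)
            * blaschkeFactor lam z ^ (i : ℕ) := by
      rw [Finset.mul_sum]
      refine Finset.sum_congr rfl fun i _ => ?_
      simp only [toeplitzMatrix, Matrix.of_apply, malmquistWalsh, Fin.ext_iff, Fin.lt_def]
      ring
    rw [h2, h, malmquistWalsh]
    field_simp
  have hT : modelFun lam ((toeplitzMatrix lam n).mulVec x) z =
      ∑ j : Fin n, x j * ∑ i : Fin n, toeplitzMatrix lam n i j * malmquistWalsh lam i z := by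
    simp only [modelFun, Matrix.mulVec, dotProduct, Finset.sum_mul, Finset.mul_sum]
    rw [Finset.sum_comm]
    exact Finset.sum_congr rfl fun _ _ => Finset.sum_congr rfl fun _ _ => by ring
  rw [hT]
  simp only [hcol, modelFun, shiftDefect, Finset.mul_sum, Finset.sum_mul,
    ← Finset.sum_add_distrib]
  exact Finset.sum_congr rfl fun _ _ => by ring

end modelFun

section modelNorm

variable {n : ℕ}

theorem memWiener_modelFun_add (h0 : 0 < lam) (h1 : lam < 1) (x : Fin n → ℂ) {g : ℂ → ℂ}
    (hg : MemWiener g) : MemWiener fun z => modelFun lam x z + blaschkeFactor lam z ^ n * g z :=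
  (memWiener_modelFun h0 h1 x).add (((memWiener_blaschkeFactor h0 h1).pow n).mul hg)

theorem modelNorm_le (x : Fin n → ℂ) {g : ℂ → ℂ} (hg : MemWiener g) :
    modelNorm lam n x ≤
      wienerNorm fun z => modelFun lam x z + blaschkeFactor lam z ^ n * g z :=
  csInf_le ⟨0, by rintro r ⟨g, -, rfl⟩; exact wienerNorm_nonneg _⟩ ⟨g, hg, rfl⟩

theorem le_modelNorm {x : Fin n → ℂ} {r : ℝ} (h : ∀ g, MemWiener g →
      r ≤ wienerNorm fun z => modelFun lam x z + blaschkeFactor lam z ^ n * g z) :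
    r ≤ modelNorm lam n x :=
  le_csInf ⟨_, _, MemWiener.const 0, rfl⟩ (by rintro r ⟨g, hg, rfl⟩; exact h g hg)

theorem modelNorm_nonneg (x : Fin n → ℂ) : 0 ≤ modelNorm lam n x :=
  le_modelNorm fun _ _ => wienerNorm_nonneg _

theorem modelNorm_le_wienerNorm (x : Fin n → ℂ) :
    modelNorm lam n x ≤ wienerNorm (modelFun lam x) := by
  simpa using modelNorm_le (lam := lam) x (MemWiener.const 0)

theorem modelNorm_smul_le (h0 : 0 < lam) (h1 : lam < 1) (c : ℂ) (x : Fin n → ℂ) :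
    modelNorm lam n (c • x) ≤ ‖c‖ * modelNorm lam n x := by
  rcases eq_or_ne c 0 with rfl | hc
  · refine (modelNorm_le_wienerNorm _).trans_eq ?_
    have : modelFun lam ((0 : ℂ) • x) = fun _ => 0 := by ext z; simp [modelFun]
    rw [this, wienerNorm_const]; simp
  rw [← div_le_iff₀' (norm_pos_iff.2 hc)]
  refine le_modelNorm fun g hg => ?_
  rw [div_le_iff₀' (norm_pos_iff.2 hc)]
  refine (modelNorm_le _ ((MemWiener.const c).mul hg)).trans ?_
  have h := wienerNorm_mul_le (MemWiener.const c) (memWiener_modelFun_add h0 h1 x hg)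
  rw [wienerNorm_const] at h
  refine (le_of_eq ?_).trans h
  congr 1 with z
  rw [modelFun_smul]; ring

theorem modelNorm_smul (h0 : 0 < lam) (h1 : lam < 1) (c : ℂ) (x : Fin n → ℂ) :
    modelNorm lam n (c • x) = ‖c‖ * modelNorm lam n x := by
  refine le_antisymm (modelNorm_smul_le h0 h1 c x) ?_
  rcases eq_or_ne c 0 with rfl | hc
  · simpa using modelNorm_nonneg _
  have h := modelNorm_smul_le h0 h1 c⁻¹ (c • x)
  rwa [inv_smul_smul₀ hc, norm_inv, ← div_eq_inv_mul, le_div_iff₀' (norm_pos_iff.2 hc)] at h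

theorem modelNorm_add_le (h0 : 0 < lam) (h1 : lam < 1) (x y : Fin n → ℂ) :
    modelNorm lam n (x + y) ≤ modelNorm lam n x + modelNorm lam n y := by
  rw [← sub_le_iff_le_add]
  refine le_modelNorm fun g hg => ?_
  rw [sub_le_comm]
  refine le_modelNorm fun k hk => ?_
  rw [sub_le_iff_le_add']
  refine (modelNorm_le _ (hg.add hk)).trans ((le_of_eq ?_).trans
    (wienerNorm_add_le (memWiener_modelFun_add h0 h1 x hg) (memWiener_modelFun_add h0 h1 y hk)))
  congr 1 with z
  rw [modelFun_add]; ring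

theorem modelNorm_toeplitz_mulVec_le (h0 : 0 < lam) (h1 : lam < 1) (x : Fin n → ℂ) :
    modelNorm lam n ((toeplitzMatrix lam n).mulVec x) ≤ modelNorm lam n x := by
  refine le_modelNorm fun g hg => ?_
  have h := wienerNorm_mul_le MemWiener.id (memWiener_modelFun_add h0 h1 x hg)
  rw [wienerNorm_id, one_mul] at h
  refine (modelNorm_le _ ((MemWiener.const (shiftDefect lam x)).add
    (MemWiener.id.mul hg))).trans ((le_of_eq ?_).trans h)
  refine wienerNorm_congr (MemWiener.id.mul (memWiener_modelFun_add h0 h1 x hg)) fun z hz => ?_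
  have := mul_modelFun x (one_sub_mul_ne_zero h0 h1 (ball_subset_closedBall hz))
  linear_combination -this

theorem wienerExt_modelFun_add (h0 : 0 < lam) (h1 : lam < 1) (x : Fin n → ℂ) {g : ℂ → ℂ}
    (hg : MemWiener g) {z : ℂ} (hz : z ∈ closedBall (0 : ℂ) 1) :
    wienerExt (fun z => modelFun lam x z + blaschkeFactor lam z ^ n * g z) z =
      modelFun lam x z + blaschkeFactor lam z ^ n * wienerExt g z := by
  refine wienerExt_eq_of_continuousOn (memWiener_modelFun_add h0 h1 x hg)
    (F := fun z => modelFun lam x z + blaschkeFactor lam z ^ n * wienerExt g z)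
    ?_ (fun w hw => by rw [wienerExt_eq hg hw]) hz
  have h2 : ContinuousOn (modelFun lam x) (closedBall 0 1) := fun w hw =>
    (differentiableAt_modelFun x (one_sub_mul_ne_zero h0 h1 hw)).continuousAt.continuousWithinAt
  have h3 : ContinuousOn (blaschkeFactor lam) (closedBall 0 1) := fun w hw =>
    (differentiableAt_blaschkeFactor
      (one_sub_mul_ne_zero h0 h1 hw)).continuousAt.continuousWithinAt
  exact h2.add ((h3.pow n).mul (continuousOn_wienerExt hg))

theorem blaschkeFactor_ne_zero (h0 : 0 < lam) (h1 : lam < 1) {z : ℂ}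
    (hz : z ∈ closedBall (0 : ℂ) 1) (hzl : z ≠ lam) : blaschkeFactor lam z ≠ 0 :=
  div_ne_zero (sub_ne_zero.2 hzl) (one_sub_mul_ne_zero h0 h1 hz)

theorem ne_of_mem_unit_sphere (h0 : 0 < lam) (h1 : lam < 1) {z : ℂ} (hz : z ∈ sphere (0 : ℂ) 1) :
    z ≠ lam := by
  rintro rfl
  simp [abs_of_pos h0] at hz
  exact h1.ne hz

theorem eq_zero_of_modelNorm_eq_zero (h0 : 0 < lam) (h1 : lam < 1) {x : Fin n → ℂ}
    (hx : modelNorm lam n x = 0) : x = 0 := by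
  by_contra hne
  obtain ⟨i, hi⟩ := Function.ne_iff.1 hne
  obtain ⟨j, hj, hmin⟩ : ∃ j : Fin n, x j ≠ 0 ∧ ∀ i < j, x i = 0 := by
    obtain ⟨j, hj, hm⟩ := WellFounded.has_min (wellFounded_lt (α := Fin n)) {i | x i ≠ 0} ⟨i, hi⟩
    exact ⟨j, hj, fun i hij => by_contra fun h => hm i h hij⟩
  let G : ℂ → ℂ := fun z => 1 / ((1 - lam * z) * blaschkeFactor lam z ^ ((j : ℕ) + 1))
  have hG : ContinuousOn G (sphere 0 1) := by
    intro z hz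
    have hz' := sphere_subset_closedBall hz
    have h2 := one_sub_mul_ne_zero h0 h1 hz'
    have h3 := differentiableAt_blaschkeFactor h2
    have h4 := blaschkeFactor_ne_zero h0 h1 hz' (ne_of_mem_unit_sphere h0 h1 hz)
    refine ContinuousAt.continuousWithinAt (DifferentiableAt.continuousAt (𝕜 := ℂ) ?_)
    exact DifferentiableAt.div (by fun_prop) (by fun_prop) (mul_ne_zero h2 (pow_ne_zero _ h4))
  obtain ⟨K, hK⟩ := (isCompact_sphere (0 : ℂ) 1).exists_bound_of_continuousOn hG
  have hK' : ∀ k : ℕ, ‖∮ z in C(0, 1), z ^ k * G z‖ ≤ 2 * Real.pi * 1 * K := fun k =>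
    circleIntegral.norm_integral_le_of_norm_le_const zero_le_one fun z hz => by
      rw [norm_mul, norm_pow, mem_sphere_zero_iff_norm.1 hz, one_pow, one_mul]
      exact hK z hz
  have hK0 : 0 ≤ K := (norm_nonneg _).trans (hK 1 (by simp))
  set s : ℂ := (Real.sqrt (1 - lam ^ 2) : ℂ) with hs
  have hs0 : s ≠ 0 := by
    rw [hs, Complex.ofReal_ne_zero]
    exact (Real.sqrt_pos.2 (by nlinarith)).ne'
  set v : ℂ := 2 * Real.pi * Complex.I * (x j * (s / (1 - lam * lam))) with hv
  have hlam : (lam : ℂ) ∈ ball (0 : ℂ) 1 := by simp [abs_of_pos h0, h1]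
  have hv0 : v ≠ 0 := by
    have := one_sub_mul_ne_zero h0 h1 (ball_subset_closedBall hlam)
    simp [hv, hj, hs0, this, Real.pi_ne_zero]
  have hval : ∀ g, MemWiener g → ‖v‖ ≤ 2 * Real.pi * 1 * K *
      wienerNorm fun z => modelFun lam x z + blaschkeFactor lam z ^ n * g z := by
    intro g hg
    refine (le_of_eq ?_).trans
      (norm_circleIntegral_wienerExt_mul_le (memWiener_modelFun_add h0 h1 x hg) hG hK')
    congr 1
    let H : ℂ → ℂ := fun z => (∑ i : Fin n, x i * (s / (1 - lam * z)
      * blaschkeFactor lam z ^ ((i : ℕ) - j))) + blaschkeFactor lam z ^ (n - j) * wienerExt g z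
    have hH : DiffContOnCl ℂ H (ball 0 1) := by
      change DiffContOnCl ℂ (fun z => (∑ i : Fin n, x i * (s / (1 - lam * z)
        * blaschkeFactor lam z ^ ((i : ℕ) - j))) + blaschkeFactor lam z ^ (n - j) • wienerExt g z) _
      refine DiffContOnCl.add (DifferentiableOn.diffContOnCl fun z hz => ?_)
        (DiffContOnCl.smul (DifferentiableOn.diffContOnCl fun z hz => ?_)
          (diffContOnCl_wienerExt hg)) <;>
      · rw [closure_ball _ one_ne_zero] at hz
        have h2 := one_sub_mul_ne_zero h0 h1 hz
        have h3 := differentiableAt_blaschkeFactor h2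
        refine DifferentiableAt.differentiableWithinAt ?_
        fun_prop (disch := assumption)
    have hHl : H lam = x j * (s / (1 - lam * lam)) := by
      have hb : blaschkeFactor lam lam = 0 := by simp [blaschkeFactor]
      have : (n - (j : ℕ)) ≠ 0 := by omega
      simp only [H, hb, zero_pow this, zero_mul, add_zero]
      rw [Finset.sum_eq_single j]
      · simp
      · intro i _ hij
        rcases lt_or_gt_of_ne hij with h | h
        · rw [hmin i h, zero_mul]
        · rw [zero_pow (by have := Fin.lt_def.1 h; omega)]; simp
      · simp
    have hC := hH.circleIntegral_sub_inv_smul hlam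
    rw [hHl, smul_eq_mul] at hC
    rw [hv, ← hC]
    refine circleIntegral.integral_congr zero_le_one fun z hz => ?_
    have hz' := sphere_subset_closedBall hz
    have h2 := one_sub_mul_ne_zero h0 h1 hz'
    have h4 := blaschkeFactor_ne_zero h0 h1 hz' (ne_of_mem_unit_sphere h0 h1 hz)
    have h5 : z - lam ≠ 0 := sub_ne_zero.2 (ne_of_mem_unit_sphere h0 h1 hz)
    have hF : modelFun lam x z + blaschkeFactor lam z ^ n * wienerExt g z =
        blaschkeFactor lam z ^ (j : ℕ) * H z := by
      simp only [H, mul_add, Finset.mul_sum, modelFun]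
      congr 1
      · refine Finset.sum_congr rfl fun i _ => ?_
        rcases lt_or_ge i j with h | h
        · rw [hmin i h]; simp
        · have : (i : ℕ) = j + (i - j) := by have := Fin.le_def.1 h; omega
          rw [malmquistWalsh]
          conv_lhs => rw [this, pow_add]
          ring
      · rw [← mul_assoc, ← pow_add, show (j : ℕ) + (n - j) = n by omega]
    simp only [smul_eq_mul]
    rw [wienerExt_modelFun_add h0 h1 x hg hz', hF, ← blaschkeFactor_mul z h2]
    simp only [G]
    field_simp
    ring
  rcases hK0.eq_or_lt with hK0 | hK0
  · have := hval _ (MemWiener.const 0)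
    rw [← hK0] at this
    simp at this
    exact hv0 this
  · have hpos : 0 < 2 * Real.pi * 1 * K := by positivity
    have : ‖v‖ / (2 * Real.pi * 1 * K) ≤ modelNorm lam n x := le_modelNorm fun g hg => by
      rw [div_le_iff₀' hpos]; exact hval g hg
    rw [hx] at this
    exact this.not_gt (div_pos (norm_pos_iff.2 hv0) hpos)

theorem isVectorNorm_modelNorm (h0 : 0 < lam) (h1 : lam < 1) (n : ℕ) :
    IsVectorNorm (modelNorm lam n) where
  eq_zero_iff x := ⟨eq_zero_of_modelNorm_eq_zero h0 h1, by
    rintro rfl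
    simpa using modelNorm_smul h0 h1 0 (0 : Fin n → ℂ)⟩
  smul := modelNorm_smul h0 h1
  add_le := modelNorm_add_le h0 h1

end modelNorm

section inducedNorm

variable {n : ℕ} {N : (Fin n → ℂ) → ℝ}

theorem IsVectorNorm.nonneg (hN : IsVectorNorm N) (x : Fin n → ℂ) : 0 ≤ N x := by
  have h := hN.add_le x ((-1 : ℂ) • x)
  rw [hN.smul, neg_one_smul, add_neg_cancel, (hN.eq_zero_iff 0).2 rfl] at h
  simp at h
  linarith

theorem IsVectorNorm.le_mul_norm (hN : IsVectorNorm N) (x : Fin n → ℂ) :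
    N x ≤ (∑ i, N (Pi.single i 1)) * ‖x‖ := by
  have h : ∀ s : Finset (Fin n), N (∑ i ∈ s, x i • Pi.single i (1 : ℂ)) ≤
      ∑ i ∈ s, N (Pi.single i 1) * ‖x‖ := by
    intro s
    induction s using Finset.induction_on with
    | empty => simp [(hN.eq_zero_iff 0).2 rfl]
    | insert i s hi ih =>
      rw [Finset.sum_insert hi, Finset.sum_insert hi]
      refine (hN.add_le _ _).trans (add_le_add ?_ ih)
      rw [hN.smul, mul_comm]
      exact mul_le_mul_of_nonneg_left (norm_le_pi_norm x i) (hN.nonneg _)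
  have hx : x = ∑ i, x i • Pi.single i (1 : ℂ) := by
    simpa [← Pi.single_smul'] using (Finset.univ_sum_single x).symm
  rw [Finset.sum_mul]
  conv_lhs => rw [hx]
  exact h _

theorem IsVectorNorm.exists_norm_le (hN : IsVectorNorm N) :
    ∃ c : ℝ, 0 < c ∧ ∀ x, c * ‖x‖ ≤ N x := by
  set K := ∑ i, N (Pi.single i 1)
  have hK : 0 ≤ K := Finset.sum_nonneg fun i _ => hN.nonneg _
  have hsub : ∀ x y, N x - N y ≤ K * ‖x - y‖ := fun x y => by
    have := hN.add_le (x - y) y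
    rw [sub_add_cancel] at this
    linarith [hN.le_mul_norm (x - y)]
  have hcont : Continuous N := by
    refine (LipschitzWith.of_dist_le_mul (K := ⟨K, hK⟩) fun x y => ?_).continuous
    rw [Real.dist_eq, dist_eq_norm, abs_sub_le_iff]
    exact ⟨hsub x y, by rw [norm_sub_rev]; exact hsub y x⟩
  rcases (sphere (0 : Fin n → ℂ) 1).eq_empty_or_nonempty with h | h
  · refine ⟨1, one_pos, fun x => ?_⟩
    rcases eq_or_ne x 0 with rfl | hx
    · simp [hN.nonneg]
    · have : ((‖x‖ : ℂ)⁻¹ • x) ∈ sphere (0 : Fin n → ℂ) 1 := by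
        simp [norm_smul, hx]
      rw [h] at this
      exact this.elim
  · obtain ⟨u, hu, hmin⟩ := (isCompact_sphere (0 : Fin n → ℂ) 1).exists_isMinOn h hcont.continuousOn
    have hu0 : u ≠ 0 := by rintro rfl; simp at hu
    refine ⟨N u, (hN.nonneg u).lt_of_ne fun h => hu0 ((hN.eq_zero_iff u).1 h.symm), fun x => ?_⟩
    rcases eq_or_ne x 0 with rfl | hx
    · simp [hN.nonneg]
    · have hm : ((‖x‖ : ℂ)⁻¹ • x) ∈ sphere (0 : Fin n → ℂ) 1 := by
        simp [norm_smul, hx]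
      have := isMinOn_iff.1 hmin _ hm
      rw [hN.smul, norm_inv, Complex.norm_real, norm_norm, ← div_eq_inv_mul,
        le_div_iff₀ (norm_pos_iff.2 hx)] at this
      exact this

theorem IsVectorNorm.le_inducedNorm (hN : IsVectorNorm N) (A : Matrix (Fin n) (Fin n) ℂ)
    {x : Fin n → ℂ} (hx : N x ≤ 1) : N (A.mulVec x) ≤ inducedNorm N A := by
  refine le_csSup ?_ ⟨x, hx, rfl⟩
  obtain ⟨c, hc, hcN⟩ := hN.exists_norm_le
  let f := (Matrix.mulVecLin A).toContinuousLinearMap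
  refine ⟨(∑ i, N (Pi.single i 1)) * (‖f‖ * c⁻¹), ?_⟩
  rintro r ⟨y, hy, rfl⟩
  refine (hN.le_mul_norm _).trans (mul_le_mul_of_nonneg_left ?_
    (Finset.sum_nonneg fun i _ => hN.nonneg _))
  refine (f.le_opNorm y).trans (mul_le_mul_of_nonneg_left ?_ (norm_nonneg _))
  rw [← one_div, le_div_iff₀' hc]
  exact (hcN y).trans hy

end inducedNorm

theorem inducedNorm_toeplitzMatrix_le_one (h0 : 0 < lam) (h1 : lam < 1) (n : ℕ) :
    inducedNorm (modelNorm lam n) (toeplitzMatrix lam n) ≤ 1 := by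
  refine Real.sSup_le ?_ zero_le_one
  rintro r ⟨x, hx, rfl⟩
  exact (modelNorm_toeplitz_mulVec_le h0 h1 x).trans hx

theorem isUnit_smul_one_sub_toeplitzMatrix {ζ : ℂ} (hζ : ζ ≠ lam) (n : ℕ) :
    IsUnit (ζ • (1 : Matrix (Fin n) (Fin n) ℂ) - toeplitzMatrix lam n) := by
  rw [Matrix.isUnit_iff_isUnit_det, Matrix.det_of_isLowerTriangular]
  · simp only [Matrix.sub_apply, Matrix.smul_apply, Matrix.one_apply_eq, toeplitzMatrix,
      Matrix.of_apply, if_true]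
    simp [sub_ne_zero.2 hζ]
  · intro i j hij
    have hij : i < j := hij
    simp [toeplitzMatrix, hij.ne, hij.not_gt]

/-- A weighted form of van der Corput's second derivative test: the weight is dominated by the
second derivative of the phase. -/
theorem norm_integral_le_of_weight_le_deriv {a b δ A B D σ : ℝ} (hab : a ≤ b) (hδ : 0 < δ)
    {E φ φ' : ℝ → ℂ} {M M' : ℝ → ℝ}
    (hE : ∀ t, HasDerivAt E (Complex.I * M t * E t) t) (hE1 : ∀ t, ‖E t‖ = 1)
    (hM : ∀ t, HasDerivAt M (M' t) t) (hM' : Continuous M')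
    (hφ : ∀ t, HasDerivAt φ (φ' t) t) (hφ' : Continuous φ')
    (hσ : |σ| ≤ 1) (hsign : ∀ t ∈ Set.Icc a b, |M' t| = σ * M' t)
    (ha : φ a = 0) (hb : φ b = 0) (hA : ∀ t ∈ Set.Icc a b, ‖φ t‖ ≤ A)
    (hB : ∀ t ∈ Set.Icc a b, ‖φ t‖ * δ ^ 2 ≤ B * |M' t|)
    (hD : ∀ t ∈ Set.Icc a b, ‖φ' t‖ ≤ D) (hAB : 0 ≤ A + B) :
    ‖∫ t in a..b, E t * φ t‖ ≤ ((A + B) * Real.pi + D * (b - a)) / δ := by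
  have hW : ∀ t, 0 < M t ^ 2 + δ ^ 2 := fun t => by positivity
  have hWc : ∀ t, (M t : ℂ) ^ 2 + (δ : ℂ) ^ 2 ≠ 0 := fun t => by exact_mod_cast (hW t).ne'
  set Q : ℝ → ℝ := fun t => M t / (M t ^ 2 + δ ^ 2) with hQ
  set Q' : ℝ → ℝ := fun t => M' t * (δ ^ 2 - M t ^ 2) / (M t ^ 2 + δ ^ 2) ^ 2 with hQ'
  have hMc : Continuous M := continuous_iff_continuousAt.2 fun t => (hM t).continuousAt
  have hEc : Continuous E := continuous_iff_continuousAt.2 fun t => (hE t).continuousAt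
  have hφc : Continuous φ := continuous_iff_continuousAt.2 fun t => (hφ t).continuousAt
  have hQd : ∀ t, HasDerivAt Q (Q' t) t := fun t => by
    refine ((hM t).fun_div (((hM t).fun_pow 2).add_const (δ ^ 2)) (hW t).ne').congr_deriv ?_
    simp only [hQ']
    push_cast
    ring
  have hQc : Continuous Q := hMc.div (by fun_prop) fun t => (hW t).ne'
  have hQ'c : Continuous Q' :=
    Continuous.div (by fun_prop) (by fun_prop) fun t => pow_ne_zero 2 (hW t).ne'
  set R : ℝ → ℂ := fun t => E t * (φ t * (δ ^ 2 / (M t ^ 2 + δ ^ 2) : ℝ)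
    + Complex.I * (φ' t * Q t + φ t * Q' t)) with hR
  have hRc : Continuous R := by
    have : Continuous fun t => δ ^ 2 / (M t ^ 2 + δ ^ 2) :=
      Continuous.div (by fun_prop) (by fun_prop) fun t => (hW t).ne'
    fun_prop
  have hFd : ∀ t, HasDerivAt (fun t => -Complex.I * (E t * φ t * Q t)) (E t * φ t - R t) t := by
    intro t
    refine ((((hE t).fun_mul (hφ t)).fun_mul
      (hQd t).ofReal_comp).const_mul (-Complex.I)).congr_deriv ?_
    simp only [hR, hQ]
    push_cast
    have := hWc t
    field_simp
    linear_combination (-(E t * φ t * (M t) ^ 2)) * Complex.I_sq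
  have hEφ : Continuous fun t => E t * φ t := hEc.mul hφc
  have hint : ∫ t in a..b, E t * φ t = ∫ t in a..b, R t := by
    have h := intervalIntegral.integral_eq_sub_of_hasDerivAt (fun t _ => hFd t)
      ((hEφ.sub hRc).intervalIntegrable a b)
    rw [intervalIntegral.integral_sub (hEφ.intervalIntegrable a b)
      (hRc.intervalIntegrable a b), ha, hb] at h
    simpa [sub_eq_zero] using h
  have hatd : ∀ t, HasDerivAt (fun t => Real.arctan (M t / δ) / δ)
      (M' t / (M t ^ 2 + δ ^ 2)) t := fun t => by
    refine ((((hM t).div_const δ).arctan).div_const δ).congr_deriv ?_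
    have := (hW t).ne'
    field_simp
    ring
  have hKc : Continuous fun t => M' t / (M t ^ 2 + δ ^ 2) :=
    hM'.div (by fun_prop) fun t => (hW t).ne'
  have hbound : ∀ t ∈ Set.Icc a b,
      ‖R t‖ ≤ (A + B) * σ * (M' t / (M t ^ 2 + δ ^ 2)) + D / δ := by
    intro t ht
    have hQle : |Q t| ≤ 1 / δ := by
      simp only [hQ]
      rw [abs_div, abs_of_pos (hW t), div_le_div_iff₀ (hW t) hδ]
      nlinarith [sq_nonneg (|M t| - δ), sq_abs (M t), sq_nonneg (M t)]
    have hQ'le : |Q' t| ≤ |M' t| / (M t ^ 2 + δ ^ 2) := by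
      simp only [hQ']
      rw [abs_div, abs_mul, abs_of_pos (pow_pos (hW t) 2), div_le_div_iff₀ (pow_pos (hW t) 2) (hW t)]
      have : |δ ^ 2 - M t ^ 2| ≤ M t ^ 2 + δ ^ 2 := by
        rw [abs_le]; constructor <;> nlinarith [sq_nonneg (M t), sq_nonneg δ]
      calc |M' t| * |δ ^ 2 - M t ^ 2| * (M t ^ 2 + δ ^ 2)
          ≤ |M' t| * (M t ^ 2 + δ ^ 2) * (M t ^ 2 + δ ^ 2) := by gcongr
        _ = _ := by ring
    have hφ0 := norm_nonneg (φ t)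
    have e1 : ‖φ t * (δ ^ 2 / (M t ^ 2 + δ ^ 2) : ℝ)‖ ≤ B * (|M' t| / (M t ^ 2 + δ ^ 2)) := by
      rw [norm_mul, Complex.norm_real, Real.norm_eq_abs, abs_of_pos (div_pos (by positivity) (hW t)),
        ← mul_div_assoc, ← mul_div_assoc]
      exact div_le_div_of_nonneg_right (hB t ht) (hW t).le
    have e2 : ‖φ' t * Q t‖ ≤ D * (1 / δ) := by
      rw [norm_mul, Complex.norm_real, Real.norm_eq_abs]
      exact mul_le_mul (hD t ht) hQle (abs_nonneg _) ((norm_nonneg _).trans (hD t ht))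
    have e3 : ‖φ t * Q' t‖ ≤ A * (|M' t| / (M t ^ 2 + δ ^ 2)) := by
      rw [norm_mul, Complex.norm_real, Real.norm_eq_abs]
      exact mul_le_mul (hA t ht) hQ'le (abs_nonneg _) (hφ0.trans (hA t ht))
    calc ‖R t‖ ≤ ‖φ t * (δ ^ 2 / (M t ^ 2 + δ ^ 2) : ℝ)‖ + (‖φ' t * Q t‖ + ‖φ t * Q' t‖) := by
          simp only [hR]
          rw [norm_mul, hE1, one_mul]
          refine (norm_add_le _ _).trans (add_le_add_right ?_ _)
          rw [norm_mul, Complex.norm_I, one_mul]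
          exact norm_add_le _ _
      _ ≤ B * (|M' t| / (M t ^ 2 + δ ^ 2)) + (D * (1 / δ) + A * (|M' t| / (M t ^ 2 + δ ^ 2))) :=
          add_le_add e1 (add_le_add e2 e3)
      _ = _ := by rw [hsign t ht]; ring
  have hat : ∀ x : ℝ, |Real.arctan x| ≤ Real.pi / 2 := fun x =>
    abs_le.2 ⟨(Real.neg_pi_div_two_lt_arctan x).le, (Real.arctan_lt_pi_div_two x).le⟩
  rw [hint]
  calc ‖∫ t in a..b, R t‖
      ≤ ∫ t in a..b, ((A + B) * σ * (M' t / (M t ^ 2 + δ ^ 2)) + D / δ) :=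
        intervalIntegral.norm_integral_le_of_norm_le hab
          (Eventually.of_forall fun t ht => hbound t (Set.Ioc_subset_Icc_self ht))
          (Continuous.intervalIntegrable (by fun_prop) a b)
    _ = (A + B) * (σ * (Real.arctan (M b / δ) - Real.arctan (M a / δ))) / δ + D * (b - a) / δ := by
        rw [intervalIntegral.integral_add (Continuous.intervalIntegrable (by fun_prop) a b)
          intervalIntegrable_const, intervalIntegral.integral_const_mul,
          intervalIntegral.integral_eq_sub_of_hasDerivAt (fun t _ => hatd t)
            (hKc.intervalIntegrable a b), intervalIntegral.integral_const, smul_eq_mul]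
        ring
    _ ≤ (A + B) * Real.pi / δ + D * (b - a) / δ := by
        gcongr
        have h1 := hat (M b / δ)
        have h2 := hat (M a / δ)
        calc σ * (Real.arctan (M b / δ) - Real.arctan (M a / δ))
            ≤ |σ| * |Real.arctan (M b / δ) - Real.arctan (M a / δ)| := by
              rw [← abs_mul]; exact le_abs_self _
          _ ≤ 1 * Real.pi := by
              refine mul_le_mul hσ ((abs_sub _ _).trans (by linarith)) (abs_nonneg _) zero_le_one
          _ = _ := one_mul _
    _ = _ := by ring

theorem HasDerivAt.pow_of_phase {u : ℝ → ℂ} {p : ℂ} {t : ℝ}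
    (hu : HasDerivAt u (Complex.I * p * u t) t) (n : ℕ) :
    HasDerivAt (fun t => u t ^ n) (Complex.I * (n * p) * u t ^ n) t := by
  refine (hu.fun_pow n).congr_deriv ?_
  cases n with
  | zero => simp
  | succ n => rw [Nat.add_sub_cancel, pow_succ]; ring

section BlaschkePhase

variable {lam : ℝ}

theorem exp_mul_I_add_inv (t : ℝ) :
    Complex.exp (t * Complex.I) + (Complex.exp (t * Complex.I))⁻¹ = 2 * Real.cos t := by
  rw [← Complex.exp_neg, Complex.ofReal_cos, Complex.cos]; ring_nf

theorem one_sub_exp_mul_I_sq (t : ℝ) :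
    1 - Complex.exp (t * Complex.I) ^ 2 =
      -(2 * Complex.I * Real.sin t * Complex.exp (t * Complex.I)) := by
  have h : Complex.exp (-(t * Complex.I)) * Complex.exp (t * Complex.I) = 1 := by
    rw [← Complex.exp_add]; simp
  rw [Complex.ofReal_sin, Complex.sin, neg_mul]
  linear_combination -h + (Complex.exp (-(t * Complex.I)) * Complex.exp (t * Complex.I)
      - Complex.exp (t * Complex.I) ^ 2) * Complex.I_sq

theorem one_sub_mul_exp_normSq (lam t : ℝ) :
    ‖1 - lam * Complex.exp (t * Complex.I)‖ ^ 2 = 1 - 2 * lam * Real.cos t + lam ^ 2 := by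
  rw [Complex.sq_norm, Complex.normSq_apply]
  simp [Complex.exp_ofReal_mul_I_re, Complex.exp_ofReal_mul_I_im]
  nlinarith [Real.sin_sq_add_cos_sq t]

theorem norm_blaschkeFactor_exp (h0 : 0 < lam) (h1 : lam < 1) (t : ℝ) :
    ‖blaschkeFactor lam (Complex.exp (t * Complex.I))‖ = 1 := by
  have hz : Complex.exp (t * Complex.I) ∈ closedBall (0 : ℂ) 1 := by
    simp [Complex.norm_exp_ofReal_mul_I]
  have h := norm_pos_iff.2 (one_sub_mul_ne_zero h0 h1 hz)
  rw [blaschkeFactor, norm_div, div_eq_one_iff_eq h.ne',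
    ← sq_eq_sq₀ (norm_nonneg _) (norm_nonneg _), one_sub_mul_exp_normSq, Complex.sq_norm,
    Complex.normSq_apply]
  simp [Complex.exp_ofReal_mul_I_re, Complex.exp_ofReal_mul_I_im]
  nlinarith [Real.sin_sq_add_cos_sq t]

theorem poissonDenom_pos (h0 : 0 < lam) (h1 : lam < 1) (t : ℝ) :
    0 < 1 - 2 * lam * Real.cos t + lam ^ 2 := by
  nlinarith [Real.cos_le_one t, sq_pos_of_pos (sub_pos.2 h1)]

theorem hasDerivAt_exp_mul_I (t : ℝ) :
    HasDerivAt (fun t : ℝ => Complex.exp (t * Complex.I))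
      (Complex.I * 1 * Complex.exp (t * Complex.I)) t := by
  have : HasDerivAt (fun t : ℝ => (t : ℂ) * Complex.I) (1 * Complex.I) t :=
    (Complex.ofRealCLM.hasDerivAt (x := t)).mul_const _
  convert this.cexp using 1
  ring

/-- The argument of the Blaschke factor on the unit circle moves with the speed given by the
Poisson kernel. -/
theorem hasDerivAt_blaschkeFactor_exp (h0 : 0 < lam) (h1 : lam < 1) (t : ℝ) :
    HasDerivAt (fun t : ℝ => blaschkeFactor lam (Complex.exp (t * Complex.I)))
      (Complex.I * ((1 - lam ^ 2) / (1 - 2 * lam * Real.cos t + lam ^ 2) : ℝ)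
        * blaschkeFactor lam (Complex.exp (t * Complex.I))) t := by
  have hz : Complex.exp (t * Complex.I) ∈ sphere (0 : ℂ) 1 := by
    simp [Complex.norm_exp_ofReal_mul_I]
  have h2 := one_sub_mul_ne_zero h0 h1 (sphere_subset_closedBall hz)
  have h3 := sub_ne_zero.2 (ne_of_mem_unit_sphere h0 h1 hz)
  have hd := hasDerivAt_exp_mul_I t
  have := (hd.sub_const (lam : ℂ)).fun_div ((hd.const_mul (lam : ℂ)).const_sub 1) h2
  refine this.congr_deriv ?_
  have hc := exp_mul_I_add_inv t
  have hP : (1 : ℂ) - 2 * lam * Real.cos t + lam ^ 2 =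
      (1 - lam * Complex.exp (t * Complex.I)) * (Complex.exp (t * Complex.I) - lam)
        / Complex.exp (t * Complex.I) := by
    have h4 := Complex.exp_ne_zero (t * Complex.I)
    field_simp at hc ⊢
    linear_combination lam * hc
  rw [blaschkeFactor]
  push_cast at hP ⊢
  rw [hP]
  have h4 := Complex.exp_ne_zero (t * Complex.I)
  generalize Complex.exp (t * Complex.I) = w at *
  field_simp
  ring

theorem hasDerivAt_poissonKernel (h0 : 0 < lam) (h1 : lam < 1) (t : ℝ) :
    HasDerivAt (fun t => (1 - lam ^ 2) / (1 - 2 * lam * Real.cos t + lam ^ 2))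
      (-((1 - lam ^ 2) * (2 * lam * Real.sin t) / (1 - 2 * lam * Real.cos t + lam ^ 2) ^ 2)) t := by
  have hd : HasDerivAt (fun t => 1 - 2 * lam * Real.cos t + lam ^ 2) (2 * lam * Real.sin t) t := by
    refine ((((Real.hasDerivAt_cos t).const_mul (2 * lam)).const_sub 1).add_const _).congr_deriv ?_
    ring
  refine ((hasDerivAt_const t (1 - lam ^ 2)).fun_div hd (poissonDenom_pos h0 h1 t).ne').congr_deriv ?_
  ring

/-- A weight on the unit circle which vanishes at the points where the Poisson kernel is
critical. -/
noncomputable def oscillationWeight (lam : ℝ) (z : ℂ) : ℂ := (1 - z ^ 2) / (1 - lam * z) ^ 3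

theorem exists_norm_circleIntegral_pow_mul_le (h0 : 0 < lam) (h1 : lam < 1) :
    ∃ C : ℝ, 0 < C ∧ ∀ n : ℕ, 1 ≤ n → ∀ k : ℕ,
      ‖∮ z in C(0, 1), z ^ k * (oscillationWeight lam z / blaschkeFactor lam z ^ n)‖ ≤
        C / Real.sqrt n := by
  let z : ℝ → ℂ := fun t => Complex.exp (t * Complex.I)
  have hzs : ∀ t, z t ∈ sphere (0 : ℂ) 1 := fun t => by simp [z, Complex.norm_exp_ofReal_mul_I]
  have hz1 : ∀ t, ‖z t‖ = 1 := fun t => by simp [z, Complex.norm_exp_ofReal_mul_I]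
  have hne : ∀ t, 1 - (lam : ℂ) * z t ≠ 0 := fun t =>
    one_sub_mul_ne_zero h0 h1 (sphere_subset_closedBall (hzs t))
  let φ : ℝ → ℂ := fun t => Complex.I * z t * oscillationWeight lam (z t)
  have hzsm : ContDiff ℝ 2 z := by
    have : ContDiff ℝ 2 fun t : ℝ => (t : ℂ) * Complex.I :=
      Complex.ofRealCLM.contDiff.mul contDiff_const
    exact this.cexp
  have hφsm : ContDiff ℝ 2 φ := by
    simp only [φ, oscillationWeight, div_eq_mul_inv]
    have hden : ContDiff ℝ 2 fun t => ((1 - (lam : ℂ) * z t) ^ 3)⁻¹ :=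
      ContDiff.inv (by fun_prop) fun t => pow_ne_zero 3 (hne t)
    fun_prop
  have hφd : ∀ t, HasDerivAt φ (deriv φ t) t := fun t =>
    (hφsm.differentiable (by norm_num) t).hasDerivAt
  have hφ'c : Continuous (deriv φ) := hφsm.continuous_deriv (by norm_num)
  obtain ⟨A, hA⟩ := (isCompact_Icc (a := 0) (b := 2 * Real.pi)).exists_bound_of_continuousOn
    hφsm.continuous.continuousOn
  obtain ⟨D, hD⟩ := (isCompact_Icc (a := 0) (b := 2 * Real.pi)).exists_bound_of_continuousOn
    hφ'c.continuousOn
  have hpi := Real.pi_pos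
  have hA0 : 0 ≤ A := (norm_nonneg _).trans (hA 0 ⟨le_rfl, by positivity⟩)
  have hD0 : 0 ≤ D := (norm_nonneg _).trans (hD 0 ⟨le_rfl, by positivity⟩)
  let q : ℝ → ℝ := fun t => 1 - 2 * lam * Real.cos t + lam ^ 2
  have hq : ∀ t, 0 < q t := poissonDenom_pos h0 h1
  have hl1 : 0 < 1 - lam := sub_pos.2 h1
  have hl2 : 0 < 1 - lam ^ 2 := by nlinarith
  set B : ℝ := 16 / (lam * (1 - lam ^ 2) * (1 - lam) ^ 3) with hB
  have hB0 : 0 < B := by positivity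
  have hφn : ∀ t, ‖φ t‖ ≤ 2 * |Real.sin t| / (1 - lam) ^ 3 := by
    intro t
    have hden : 1 - lam ≤ ‖1 - lam * z t‖ := by
      have := norm_sub_norm_le (1 : ℂ) (lam * z t)
      rwa [norm_one, norm_mul, hz1, mul_one, Complex.norm_real, Real.norm_eq_abs,
        abs_of_pos h0] at this
    have hnum : ‖1 - z t ^ 2‖ = 2 * |Real.sin t| := by
      have : 1 - z t ^ 2 = -(2 * Complex.I * Real.sin t * z t) := one_sub_exp_mul_I_sq t
      rw [this, norm_neg, norm_mul, hz1, norm_mul, Complex.norm_real]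
      simp
    simp only [φ, oscillationWeight]
    rw [norm_mul, norm_mul, hz1, Complex.norm_I, norm_div, norm_pow, hnum, one_mul, one_mul]
    gcongr
  let K : ℝ → ℝ := fun t => (1 - lam ^ 2) * (2 * lam * Real.sin t) / q t ^ 2
  have hKc : Continuous K := by
    refine Continuous.div (by fun_prop) ?_ fun t => pow_ne_zero 2 (hq t).ne'
    simp only [q]; fun_prop
  have hφK : ∀ t, ‖φ t‖ ≤ B * |K t| := by
    intro t
    refine (hφn t).trans ?_
    have hq4 : q t ^ 2 ≤ 16 := by
      have : q t ≤ 4 := by simp only [q]; nlinarith [Real.neg_one_le_cos t]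
      nlinarith [hq t]
    have : |K t| = (1 - lam ^ 2) * (2 * lam * |Real.sin t|) / q t ^ 2 := by
      simp only [K]
      rw [abs_div, abs_mul, abs_mul, abs_mul, abs_of_pos hl2, abs_of_pos h0, abs_two,
        abs_of_pos (pow_pos (hq t) 2)]
    rw [this, hB]
    calc 2 * |Real.sin t| / (1 - lam) ^ 3
        = 16 / (lam * (1 - lam ^ 2) * (1 - lam) ^ 3)
          * ((1 - lam ^ 2) * (2 * lam * |Real.sin t|) / 16) := by field_simp
      _ ≤ _ := by
        have := abs_nonneg (Real.sin t)
        have := pow_pos (hq t) 2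
        gcongr
  refine ⟨2 * ((A + B) * Real.pi + D * Real.pi), by positivity, fun n hn k => ?_⟩
  have hn0 : (0 : ℝ) < n := by exact_mod_cast hn
  let E : ℝ → ℂ := fun t => z t ^ k * (blaschkeFactor lam (z t) ^ n)⁻¹
  let M : ℝ → ℝ := fun t => k - n * ((1 - lam ^ 2) / q t)
  have hb0 : ∀ t, blaschkeFactor lam (z t) ≠ 0 := fun t =>
    norm_ne_zero_iff.1 (by rw [norm_blaschkeFactor_exp h0 h1 t]; exact one_ne_zero)
  have hE : ∀ t, HasDerivAt E (Complex.I * M t * E t) t := by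
    intro t
    have e1 := (hasDerivAt_exp_mul_I t).pow_of_phase k
    have e2 := ((hasDerivAt_blaschkeFactor_exp h0 h1 t).pow_of_phase n).fun_inv
      (pow_ne_zero n (hb0 t))
    refine (e1.fun_mul e2).congr_deriv ?_
    have := hb0 t
    simp only [E, M, z, q] at this ⊢
    push_cast
    field_simp
    ring
  have hE1 : ∀ t, ‖E t‖ = 1 := fun t => by
    simp only [E]
    rw [norm_mul, norm_pow, hz1, norm_inv, norm_pow, norm_blaschkeFactor_exp h0 h1 t]
    simp
  have hM : ∀ t, HasDerivAt M (n * K t) t := fun t => by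
    refine (((hasDerivAt_poissonKernel h0 h1 t).const_mul (n : ℝ)).const_sub
      (k : ℝ)).congr_deriv ?_
    simp only [K, q]
    ring
  have hint : ∮ z in C(0, 1), z ^ k * (oscillationWeight lam z / blaschkeFactor lam z ^ n) =
      (∫ t in (0 : ℝ)..Real.pi, E t * φ t) + ∫ t in Real.pi..2 * Real.pi, E t * φ t := by
    have hEc : Continuous E := continuous_iff_continuousAt.2 fun t => (hE t).continuousAt
    have hc : Continuous fun t => E t * φ t := hEc.mul hφsm.continuous
    rw [intervalIntegral.integral_add_adjacent_intervals (hc.intervalIntegrable _ _)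
      (hc.intervalIntegrable _ _), circleIntegral]
    refine intervalIntegral.integral_congr fun t _ => ?_
    simp only [deriv_circleMap, circleMap, E, φ, z, smul_eq_mul]
    simp only [Complex.ofReal_one, one_mul, zero_add]
    ring
  have hsq : Real.sqrt n ^ 2 = n := Real.sq_sqrt hn0.le
  have hsqp : 0 < Real.sqrt n := Real.sqrt_pos.2 hn0
  have hφB : ∀ t, ‖φ t‖ * Real.sqrt n ^ 2 ≤ B * |n * K t| := fun t => by
    rw [hsq, abs_mul, abs_of_pos hn0]
    calc ‖φ t‖ * n ≤ B * |K t| * n := by gcongr; exact hφK t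
      _ = _ := by ring
  have hK : ∀ t, ∃ c : ℝ, 0 < c ∧ n * K t = c * Real.sin t := fun t => by
    refine ⟨n * ((1 - lam ^ 2) * (2 * lam) / q t ^ 2), ?_, by simp only [K]; ring⟩
    have := hq t
    positivity
  have hφ0 : ∀ t, Real.sin t = 0 → φ t = 0 := fun t ht => by
    have := hφn t
    rw [ht] at this
    simpa using this
  have hI1 := norm_integral_le_of_weight_le_deriv (a := 0) (b := Real.pi) (σ := 1) (A := A)
    (B := B) (D := D) hpi.le hsqp hE hE1 hM (by fun_prop) hφd hφ'c (by simp)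
    (fun t ht => by
      obtain ⟨c, hc, h⟩ := hK t
      rw [one_mul, abs_of_nonneg]
      rw [h]
      exact mul_nonneg hc.le (Real.sin_nonneg_of_nonneg_of_le_pi ht.1 ht.2))
    (hφ0 0 Real.sin_zero) (hφ0 _ Real.sin_pi) (fun t ht => hA t ⟨ht.1, by linarith [ht.2]⟩)
    (fun t _ => hφB t) (fun t ht => hD t ⟨ht.1, by linarith [ht.2]⟩) (by positivity)
  have hI2 := norm_integral_le_of_weight_le_deriv (a := Real.pi) (b := 2 * Real.pi) (σ := -1)
    (A := A) (B := B) (D := D) (by linarith) hsqp hE hE1 hM (by fun_prop) hφd hφ'c (by simp)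
    (fun t ht => by
      obtain ⟨c, hc, h⟩ := hK t
      rw [neg_one_mul, abs_of_nonpos]
      rw [h]
      have : 0 ≤ Real.sin (t - Real.pi) :=
        Real.sin_nonneg_of_nonneg_of_le_pi (by linarith [ht.1]) (by linarith [ht.2])
      rw [Real.sin_sub_pi] at this
      nlinarith)
    (hφ0 _ Real.sin_pi) (hφ0 _ Real.sin_two_pi) (fun t ht => hA t ⟨by linarith [ht.1], ht.2⟩)
    (fun t _ => hφB t) (fun t ht => hD t ⟨by linarith [ht.1], ht.2⟩) (by positivity)
  rw [hint]
  refine (norm_add_le _ _).trans ((add_le_add hI1 hI2).trans_eq ?_)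
  ring

end BlaschkePhase

theorem norm_blaschkeFactor_of_mem_sphere (h0 : 0 < lam) (h1 : lam < 1) {z : ℂ}
    (hz : z ∈ sphere (0 : ℂ) 1) : ‖blaschkeFactor lam z‖ = 1 := by
  have h := Complex.norm_mul_exp_arg_mul_I z
  rw [mem_sphere_zero_iff_norm.1 hz, Complex.ofReal_one, one_mul] at h
  rw [← h]
  exact norm_blaschkeFactor_exp h0 h1 _

theorem norm_blaschkeFactor_lt_one (h0 : 0 < lam) (h1 : lam < 1) {z : ℂ}
    (hz : z ∈ ball (0 : ℂ) 1) : ‖blaschkeFactor lam z‖ < 1 := by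
  have h := norm_pos_iff.2 (one_sub_mul_ne_zero h0 h1 (ball_subset_closedBall hz))
  rw [blaschkeFactor, norm_div, div_lt_one h, ← sq_lt_sq₀ (norm_nonneg _) (norm_nonneg _),
    Complex.sq_norm, Complex.sq_norm, Complex.normSq_apply, Complex.normSq_apply]
  have h3 : ‖z‖ ^ 2 < 1 := by
    have := mem_ball_zero_iff.1 hz
    nlinarith [norm_nonneg z]
  rw [Complex.sq_norm, Complex.normSq_apply] at h3
  simp
  nlinarith [mul_pos (sub_pos.2 h3) (by nlinarith : 0 < 1 - lam ^ 2)]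

theorem differentiableAt_oscillationWeight {z : ℂ} (hz : 1 - (lam : ℂ) * z ≠ 0) :
    DifferentiableAt ℂ (oscillationWeight lam) z := by
  unfold oscillationWeight
  exact DifferentiableAt.div (by fun_prop) (by fun_prop) (pow_ne_zero 3 hz)

theorem oscillationWeight_ne_zero (h0 : 0 < lam) (h1 : lam < 1) {z : ℂ}
    (hz : z ∈ ball (0 : ℂ) 1) : oscillationWeight lam z ≠ 0 := by
  refine div_ne_zero (fun h => ?_)
    (pow_ne_zero 3 (one_sub_mul_ne_zero h0 h1 (ball_subset_closedBall hz)))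
  have h2 : ‖z ^ 2‖ = 1 := by rw [← sub_eq_zero.1 h, norm_one]
  rw [norm_pow] at h2
  have := mem_ball_zero_iff.1 hz
  nlinarith [norm_nonneg z]

/-- The coordinates of the multiple of the first Malmquist-Walsh function that has Wiener norm
one. -/
noncomputable def firstVector (lam : ℝ) (n : ℕ) (hn : 1 ≤ n) : Fin n → ℂ :=
  Pi.single ⟨0, hn⟩ ((1 - lam) / (Real.sqrt (1 - lam ^ 2) : ℂ))

theorem modelFun_firstVector (h0 : 0 < lam) (h1 : lam < 1) {n : ℕ} (hn : 1 ≤ n) (z : ℂ) :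
    modelFun lam (firstVector lam n hn) z = (1 - lam) * (1 / (1 - lam * z)) := by
  have hs : (Real.sqrt (1 - lam ^ 2) : ℂ) ≠ 0 := by
    rw [Complex.ofReal_ne_zero]
    exact (Real.sqrt_pos.2 (by nlinarith)).ne'
  rw [modelFun, Finset.sum_eq_single ⟨0, hn⟩]
  · simp only [firstVector, Pi.single_eq_same, malmquistWalsh, pow_zero, mul_one]
    field_simp
  · intro j _ hj
    simp [firstVector, hj]
  · simp

theorem firstVector_ne_zero (h0 : 0 < lam) (h1 : lam < 1) {n : ℕ} (hn : 1 ≤ n) :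
    firstVector lam n hn ≠ 0 := by
  intro h
  have h2 := modelFun_firstVector h0 h1 hn 0
  rw [h] at h2
  simp [modelFun] at h2
  exact (sub_pos.2 h1).ne (by exact_mod_cast h2)

theorem modelNorm_firstVector_le_one (h0 : 0 < lam) (h1 : lam < 1) {n : ℕ} (hn : 1 ≤ n) :
    modelNorm lam n (firstVector lam n hn) ≤ 1 := by
  refine (modelNorm_le_wienerNorm _).trans ?_
  rw [funext (modelFun_firstVector h0 h1 hn)]
  refine (wienerNorm_mul_le (MemWiener.const _) (memWiener_one_div h0 h1)).trans_eq ?_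
  have hl : 0 < 1 - lam := sub_pos.2 h1
  rw [wienerNorm_const, wienerNorm_one_div h0 h1, ← Complex.ofReal_one, ← Complex.ofReal_sub,
    Complex.norm_real, Real.norm_eq_abs, abs_of_pos hl, mul_inv_cancel₀ hl.ne']

/-- Solving `(ζ - T) y = x` amounts to dividing by `ζ - z` modulo `b ^ n`. -/
theorem modelFun_eq_of_sub_toeplitzMatrix_mulVec {n : ℕ} {x y : Fin n → ℂ} {ζ z : ℂ}
    (hxy : (ζ • (1 : Matrix (Fin n) (Fin n) ℂ) - toeplitzMatrix lam n).mulVec y = x)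
    (hz : 1 - (lam : ℂ) * z ≠ 0) :
    modelFun lam x z =
      (ζ - z) * modelFun lam y z + shiftDefect lam y * blaschkeFactor lam z ^ n := by
  have := mul_modelFun y hz
  rw [← hxy, Matrix.sub_mulVec, Matrix.smul_mulVec, Matrix.one_mulVec, modelFun_sub, modelFun_smul]
  linear_combination this

theorem norm_circleIntegral_resolvent_ge (h0 : 0 < lam) (h1 : lam < 1) {ζ : ℂ}
    (hζ : ζ ∈ ball (0 : ℂ) 1) :
    ∃ K : ℝ, 0 ≤ K ∧ ∀ (n : ℕ) (hn : 1 ≤ n) (y : Fin n → ℂ),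
      (ζ • (1 : Matrix (Fin n) (Fin n) ℂ) - toeplitzMatrix lam n).mulVec y =
        firstVector lam n hn → ∀ g, MemWiener g →
      2 * Real.pi * ‖(1 - lam) * (1 / (1 - lam * ζ)) * oscillationWeight lam ζ‖
          - ‖blaschkeFactor lam ζ‖ ^ n * K ≤
        ‖blaschkeFactor lam ζ‖ ^ n * ‖∮ z in C(0, 1),
          wienerExt (fun z => modelFun lam y z + blaschkeFactor lam z ^ n * g z) z
            * (oscillationWeight lam z / blaschkeFactor lam z ^ n)‖ := by
  let F : ℂ → ℂ := fun z => (1 - lam) * (1 / (1 - lam * z)) * oscillationWeight lam z / (ζ - z)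
  have hsub : ∀ z ∈ sphere (0 : ℂ) 1, ζ - z ≠ 0 := fun z hz h => by
    rw [sub_eq_zero.1 h] at hζ
    exact (mem_ball_zero_iff.1 hζ).ne (mem_sphere_zero_iff_norm.1 hz)
  have hF : ContinuousOn F (sphere 0 1) := fun z hz => by
    have h2 := one_sub_mul_ne_zero h0 h1 (sphere_subset_closedBall hz)
    have h3 := hsub z hz
    have h4 := differentiableAt_oscillationWeight h2
    refine (DifferentiableAt.continuousAt (𝕜 := ℂ) ?_).continuousWithinAt
    simp only [F]
    fun_prop (disch := assumption)
  obtain ⟨K, hK⟩ := (isCompact_sphere (0 : ℂ) 1).exists_bound_of_continuousOn hF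
  have hK0 : 0 ≤ K := (norm_nonneg _).trans (hK 1 (by simp))
  refine ⟨2 * Real.pi * K, by positivity, fun n hn y hy g hg => ?_⟩
  set γ := shiftDefect lam y with hγ
  let H : ℂ → ℂ := fun z => oscillationWeight lam z * (γ + (z - ζ) * wienerExt g z)
  have hw : DiffContOnCl ℂ (oscillationWeight lam) (ball 0 1) :=
    DifferentiableOn.diffContOnCl fun z hz => by
      rw [closure_ball _ one_ne_zero] at hz
      exact (differentiableAt_oscillationWeight
        (one_sub_mul_ne_zero h0 h1 hz)).differentiableWithinAt
  have hH : DiffContOnCl ℂ H (ball 0 1) :=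
    hw.smul ((diffContOnCl_const (c := γ)).add
      (((differentiable_id.sub_const ζ).diffContOnCl).smul (diffContOnCl_wienerExt hg)))
  have hC := hH.circleIntegral_sub_inv_smul hζ
  have hb : ∀ z ∈ sphere (0 : ℂ) 1, blaschkeFactor lam z ≠ 0 := fun z hz =>
    blaschkeFactor_ne_zero h0 h1 (sphere_subset_closedBall hz) (ne_of_mem_unit_sphere h0 h1 hz)
  have hbc : ContinuousOn (fun z => blaschkeFactor lam z ^ n) (sphere 0 1) := fun z hz =>
    ((differentiableAt_blaschkeFactor (one_sub_mul_ne_zero h0 h1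
      (sphere_subset_closedBall hz))).continuousAt.pow n).continuousWithinAt
  have hint1 : CircleIntegrable (fun z => F z / blaschkeFactor lam z ^ n) 0 1 :=
    (hF.div hbc fun z hz => pow_ne_zero n (hb z hz)).circleIntegrable zero_le_one
  have hint2 : CircleIntegrable (fun z => (z - ζ)⁻¹ • H z) 0 1 := by
    refine ContinuousOn.circleIntegrable zero_le_one (ContinuousOn.fun_smul ?_
      (hH.continuousOn_ball.mono sphere_subset_closedBall))
    exact ContinuousOn.inv₀ (by fun_prop) fun z hz h => hsub z hz (by rw [← neg_sub, h, neg_zero])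
  have hsplit : ∮ z in C(0, 1),
      wienerExt (fun z => modelFun lam y z + blaschkeFactor lam z ^ n * g z) z
        * (oscillationWeight lam z / blaschkeFactor lam z ^ n) =
      (∮ z in C(0, 1), F z / blaschkeFactor lam z ^ n) + ∮ z in C(0, 1), (z - ζ)⁻¹ • H z := by
    rw [← circleIntegral.integral_add hint1 hint2]
    refine circleIntegral.integral_congr zero_le_one fun z hz => ?_
    have hz' := sphere_subset_closedBall hz
    have h2 := one_sub_mul_ne_zero h0 h1 hz'
    have h3 := hsub z hz
    have h4 : z - ζ ≠ 0 := fun h => h3 (by rw [← neg_sub, h, neg_zero])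
    have h5 := pow_ne_zero n (hb z hz)
    have h6 := modelFun_eq_of_sub_toeplitzMatrix_mulVec hy h2
    rw [modelFun_firstVector h0 h1 hn] at h6
    simp only [F, H, smul_eq_mul]
    rw [wienerExt_modelFun_add h0 h1 y hg hz', h6, ← neg_sub z ζ, ← hγ]
    field_simp
    ring
  have hJ : ‖∮ z in C(0, 1), F z / blaschkeFactor lam z ^ n‖ ≤ 2 * Real.pi * 1 * K :=
    circleIntegral.norm_integral_le_of_norm_le_const zero_le_one fun z hz => by
      rw [norm_div, norm_pow, norm_blaschkeFactor_of_mem_sphere h0 h1 hz, one_pow, div_one]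
      exact hK z hz
  have hHζ : H ζ = oscillationWeight lam ζ * γ := by simp [H]
  have hγζ : (1 - lam) * (1 / (1 - lam * ζ)) = γ * blaschkeFactor lam ζ ^ n := by
    have := modelFun_eq_of_sub_toeplitzMatrix_mulVec hy
      (one_sub_mul_ne_zero h0 h1 (ball_subset_closedBall hζ))
    rwa [modelFun_firstVector h0 h1 hn, sub_self, zero_mul, zero_add] at this
  rw [hsplit, hC, hHζ, hγζ]
  have htri := norm_sub_norm_le (2 * Real.pi * Complex.I * (oscillationWeight lam ζ * γ))
    (-∮ z in C(0, 1), F z / blaschkeFactor lam z ^ n)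
  rw [norm_neg, sub_neg_eq_add, add_comm (2 * Real.pi * Complex.I * _)] at htri
  have hn1 : ‖2 * Real.pi * Complex.I * (oscillationWeight lam ζ * γ)‖ =
      2 * Real.pi * (‖oscillationWeight lam ζ‖ * ‖γ‖) := by
    simp [abs_of_pos Real.pi_pos]
  rw [hn1] at htri
  rw [norm_mul, norm_mul, norm_pow, smul_eq_mul]
  have hp : 0 ≤ ‖blaschkeFactor lam ζ‖ ^ n := by positivity
  have := mul_le_mul_of_nonneg_left (htri.trans' (sub_le_sub_left hJ _)) hp
  linarith

theorem exists_eventually_le_modelNorm_resolvent (h0 : 0 < lam) (h1 : lam < 1) {ζ : ℂ}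
    (hζ : ζ ∈ ball (0 : ℂ) 1) :
    ∃ c : ℝ, 0 < c ∧ ∀ᶠ n in atTop, ∀ (hn : 1 ≤ n) (y : Fin n → ℂ),
      (ζ • (1 : Matrix (Fin n) (Fin n) ℂ) - toeplitzMatrix lam n).mulVec y =
        firstVector lam n hn →
      c * Real.sqrt n ≤ ‖blaschkeFactor lam ζ‖ ^ n * modelNorm lam n y := by
  obtain ⟨K, hK0, hK⟩ := norm_circleIntegral_resolvent_ge h0 h1 hζ
  obtain ⟨C, hC0, hC⟩ := exists_norm_circleIntegral_pow_mul_le h0 h1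
  set v := ‖(1 - lam) * (1 / (1 - lam * ζ)) * oscillationWeight lam ζ‖ with hv
  have hv0 : 0 < v := by
    have h2 := one_sub_mul_ne_zero h0 h1 (ball_subset_closedBall hζ)
    have h3 : (1 - lam : ℂ) ≠ 0 := by
      rw [sub_ne_zero]; exact_mod_cast h1.ne'
    exact norm_pos_iff.2 (mul_ne_zero (mul_ne_zero h3 (one_div_ne_zero h2))
      (oscillationWeight_ne_zero h0 h1 hζ))
  have hpi := Real.pi_pos
  refine ⟨Real.pi * v / C, by positivity, ?_⟩
  have hlim : Tendsto (fun n : ℕ => ‖blaschkeFactor lam ζ‖ ^ n * K) atTop (𝓝 (0 * K)) :=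
    (tendsto_pow_atTop_nhds_zero_of_lt_one (norm_nonneg _)
      (norm_blaschkeFactor_lt_one h0 h1 hζ)).mul_const K
  rw [zero_mul] at hlim
  filter_upwards [hlim.eventually_lt_const (mul_pos hpi hv0)] with n hsmall hn y hy
  set β := ‖blaschkeFactor lam ζ‖ ^ n
  have hn0 : (0 : ℝ) < Real.sqrt n := Real.sqrt_pos.2 (by exact_mod_cast hn)
  have hβ0 : 0 ≤ β := by positivity
  have hG : ContinuousOn (fun z => oscillationWeight lam z / blaschkeFactor lam z ^ n)
      (sphere 0 1) := fun z hz => by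
    have hz' := sphere_subset_closedBall hz
    have h2 := one_sub_mul_ne_zero h0 h1 hz'
    exact ((differentiableAt_oscillationWeight h2).div ((differentiableAt_blaschkeFactor h2).pow n)
      (pow_ne_zero n (blaschkeFactor_ne_zero h0 h1 hz'
        (ne_of_mem_unit_sphere h0 h1 hz)))).continuousAt.continuousWithinAt
  have hlow : ∀ g, MemWiener g → Real.pi * v ≤ β * (C / Real.sqrt n *
      wienerNorm fun z => modelFun lam y z + blaschkeFactor lam z ^ n * g z) := by
    intro g hg
    have e1 := hK n hn y hy g hg
    have e2 := norm_circleIntegral_wienerExt_mul_le (memWiener_modelFun_add h0 h1 y hg) hG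
      (hC n hn)
    have e3 := mul_le_mul_of_nonneg_left e2 hβ0
    linarith
  have hβ : 0 < β := hβ0.lt_of_ne fun h => by
    have := hlow _ (MemWiener.const 0)
    rw [← h, zero_mul] at this
    exact this.not_gt (mul_pos hpi hv0)
  have : Real.pi * v / (β * (C / Real.sqrt n)) ≤ modelNorm lam n y := le_modelNorm fun g hg => by
    rw [div_le_iff₀' (by positivity), mul_assoc]
    exact hlow g hg
  calc Real.pi * v / C * Real.sqrt n = β * (Real.pi * v / (β * (C / Real.sqrt n))) := by
        field_simp
    _ ≤ _ := mul_le_mul_of_nonneg_left this hβ0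

theorem exists_pos_forall_mul_le_of_eventually {u v : ℕ → ℝ} (hu : ∀ n, 1 ≤ n → 0 < u n)
    (hv : ∀ n, 1 ≤ n → 0 < v n) {c : ℝ} (hc : 0 < c) (h : ∀ᶠ n in atTop, c * v n ≤ u n) :
    ∃ d : ℝ, 0 < d ∧ ∀ n, 1 ≤ n → d * v n ≤ u n := by
  obtain ⟨N, hN⟩ := eventually_atTop.1 h
  have hfin : ∀ m : ℕ, ∃ d : ℝ, 0 < d ∧ ∀ n, 1 ≤ n → n < m → d * v n ≤ u n := by
    intro m
    induction m with
    | zero => exact ⟨1, one_pos, fun n _ hn => absurd hn n.not_lt_zero⟩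
    | succ m ih =>
      obtain ⟨d, hd, h⟩ := ih
      rcases Nat.eq_zero_or_pos m with rfl | hm
      · exact ⟨1, one_pos, fun n _ hn => by omega⟩
      refine ⟨min d (u m / v m), lt_min hd (div_pos (hu m hm) (hv m hm)), fun n hn hnm => ?_⟩
      rcases (Nat.lt_succ_iff_lt_or_eq.1 hnm) with hlt | rfl
      · exact (mul_le_mul_of_nonneg_right (min_le_left _ _) (hv n hn).le).trans (h n hn hlt)
      · exact (mul_le_mul_of_nonneg_right (min_le_right _ _) (hv n hn).le).trans_eq
          (div_mul_cancel₀ _ (hv n hn).ne')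
  obtain ⟨d, hd, h⟩ := hfin N
  refine ⟨min d c, lt_min hd hc, fun n hn => ?_⟩
  rcases lt_or_ge n N with hlt | hge
  · exact (mul_le_mul_of_nonneg_right (min_le_left _ _) (hv n hn).le).trans (h n hn hlt)
  · exact (mul_le_mul_of_nonneg_right (min_le_right _ _) (hv n hn).le).trans (hN n hge)

theorem theorem4p3 (lam : ℝ) (hlam : lam ∈ Set.Ioo (0 : ℝ) 1) :
    (∀ n : ℕ, 1 ≤ n →
      IsVectorNorm (modelNorm lam n) ∧
      inducedNorm (modelNorm lam n) (toeplitzMatrix lam n) ≤ 1) ∧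
    ∀ ζ : ℂ, ζ ∈ Metric.ball (0 : ℂ) 1 → ζ ≠ (lam : ℂ) →
      ∃ d : ℝ, 0 < d ∧ ∀ n : ℕ, 1 ≤ n →
        IsUnit (ζ • (1 : Matrix (Fin n) (Fin n) ℂ) - toeplitzMatrix lam n) ∧
        d * Real.sqrt n ≤
          ‖blaschkeFactor lam ζ ^ n‖ *
            inducedNorm (modelNorm lam n)
              (ζ • (1 : Matrix (Fin n) (Fin n) ℂ) - toeplitzMatrix lam n)⁻¹ := by
  obtain ⟨h0, h1⟩ := hlam
  refine ⟨fun n _ => ⟨isVectorNorm_modelNorm h0 h1 n, inducedNorm_toeplitzMatrix_le_one h0 h1 n⟩,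
    fun ζ hζ hne => ?_⟩
  obtain ⟨c, hc, hev⟩ := exists_eventually_le_modelNorm_resolvent h0 h1 hζ
  have hsolve : ∀ (n : ℕ) (hn : 1 ≤ n),
      (ζ • (1 : Matrix (Fin n) (Fin n) ℂ) - toeplitzMatrix lam n).mulVec
        ((ζ • (1 : Matrix (Fin n) (Fin n) ℂ) - toeplitzMatrix lam n)⁻¹.mulVec
          (firstVector lam n hn)) = firstVector lam n hn := fun n hn => by
    rw [Matrix.mulVec_mulVec, Matrix.mul_nonsing_inv _ ((Matrix.isUnit_iff_isUnit_det _).1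
      (isUnit_smul_one_sub_toeplitzMatrix hne n)), Matrix.one_mulVec]
  have hle : ∀ (n : ℕ) (hn : 1 ≤ n), modelNorm lam n
      ((ζ • (1 : Matrix (Fin n) (Fin n) ℂ) - toeplitzMatrix lam n)⁻¹.mulVec
        (firstVector lam n hn)) ≤ inducedNorm (modelNorm lam n)
          (ζ • (1 : Matrix (Fin n) (Fin n) ℂ) - toeplitzMatrix lam n)⁻¹ := fun n hn =>
    (isVectorNorm_modelNorm h0 h1 n).le_inducedNorm _ (modelNorm_firstVector_le_one h0 h1 hn)
  have hb : 0 < ‖blaschkeFactor lam ζ‖ :=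
    norm_pos_iff.2 (blaschkeFactor_ne_zero h0 h1 (ball_subset_closedBall hζ) hne)
  have hpos : ∀ n, 1 ≤ n → 0 < ‖blaschkeFactor lam ζ ^ n‖ * inducedNorm (modelNorm lam n)
      (ζ • (1 : Matrix (Fin n) (Fin n) ℂ) - toeplitzMatrix lam n)⁻¹ := fun n hn => by
    rw [norm_pow]
    refine mul_pos (pow_pos hb n) (lt_of_lt_of_le ?_ (hle n hn))
    refine ((isVectorNorm_modelNorm h0 h1 n).nonneg _).lt_of_ne fun h => ?_
    have hz := ((isVectorNorm_modelNorm h0 h1 n).eq_zero_iff _).1 h.symm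
    have := hsolve n hn
    rw [hz, Matrix.mulVec_zero] at this
    exact firstVector_ne_zero h0 h1 hn this.symm
  have hlarge : ∀ᶠ n : ℕ in atTop, c * Real.sqrt n ≤
      ‖blaschkeFactor lam ζ ^ n‖ * inducedNorm (modelNorm lam n)
        (ζ • (1 : Matrix (Fin n) (Fin n) ℂ) - toeplitzMatrix lam n)⁻¹ := by
    filter_upwards [hev, eventually_ge_atTop 1] with n hn hn1
    rw [norm_pow]
    exact (hn hn1 _ (hsolve n hn1)).trans
      (mul_le_mul_of_nonneg_left (hle n hn1) (pow_pos hb n).le)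
  obtain ⟨d, hd, h⟩ := exists_pos_forall_mul_le_of_eventually hpos
    (fun n hn => Real.sqrt_pos.2 (by exact_mod_cast hn)) hc hlarge
  exact ⟨d, hd, fun n hn => ⟨isUnit_smul_one_sub_toeplitzMatrix hne n, h n hn⟩⟩
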